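/- **Setting.** The Euclidean group $\mathcal E(2)$ (all isometries of $\mathbb R^2$) acts on fields by $(\gamma\cdot\Phi)(r)=\Phi(\gamma^{-1}r)$. Let $R_\theta$ be the rotation by $\theta$ about the origin, $\gamma_1(x,y)=(-x,y)$, $\gamma_2(x,y)=(y,x)$, and let $D_4\dot+T^2\subset\mathcal E(2)$ be the subgroup generated by $\gamma_1,\gamma_2$ and all translations (translations by $2\pi$ along the axes act trivially on the periodic fields below). For $\kappa>0$ put $A(\kappa)=\{k\in\mathbb R^2:|k|=\kappa\}$ and let $E^c(\mathbb R^2)$ be the real Banach space of real fields $$\Phi(r)=\sum_{k\in A(\kappa)}a(k)\,e^{ik\cdot r},\qquad a(-k)=\overline{a(k)},\qquad \|\Phi\|=\sum_{k}|a(k)|<\infty .$$ This is the irreducible representation of $\mathcal E(2)$ with wave number $\kappa$, on which the translation by $b$ multiplies $a(k)$ by $e^{-ik\cdot b}$ and $g\in O(2)$ replaces $a(k)$ by $a(g^{-1}k)$. Let $E^c(\tilde\Omega)\subset E^c(\mathbb R^2)$ be the subspace of fields that are $2\pi$-periodic in $x$ and in $y$ (periodic boundary conditions on $\tilde\Omega=[-\pi,\pi]^2$);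 it is $D_4\dot+T^2$-invariant. For integers $l\ge n\ge 0$ with $l^2+n^2=\kappa^2$, let $V_{l,n}\subset E^c(\tilde\Omega)$ be the subspace of fields whose wave vectors lie in $\{\pm(l,n),\pm(l,-n),\pm(n,l),\pm(n,-l)\}$. A homogeneous vector field of degree $p\in\{0,1,2,\dots\}$ on a real normed space $E$ is a $C^\infty$ map $F:E\to E$ with $F(\alpha\Phi)=\alpha^pF(\Phi)$ for all $\alpha\in\mathbb R$, $\Phi\in E$. **Theorem.** Let $l_1\ge n_1\ge0$ and $l_2\ge n_2\ge0$ be integers with $l_1>l_2$ and $l_1^2+n_1^2=l_2^2+n_2^2=\kappa^2$, and suppose that $E^c(\tilde\Omega)=V_{l_1,n_1}\oplus V_{l_2,n_2}$. Let $\tilde F:E^c(\tilde\Omega)\to E^c(\tilde\Omega)$ be a $D_4\dot+T^2$-equivariant homogeneous vector field of degree $p$. Then the following are equivalent. 1. There is an $\mathcal E(2)$-equivariant homogeneous vector field $\mathcal F:E^c(\mathbb R^2)\to E^c(\mathbb R^2)$ of degree $p$ with $\tilde F=\mathcal F|_{E^c(\tilde\Omega)}$. 2. For every $\theta\in\mathbb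 R$ and every $\Phi\in E^c(\tilde\Omega)\cap R_{-\theta}E^c(\tilde\Omega)$ one has $R_\theta\cdot\tilde F(\Phi)=\tilde F(R_\theta\cdot\Phi)$. -/

import Mathlib

open scoped ContDiff Pointwise

namespace EuclideanModes

/-- The plane `ℝ²` (used both for positions and for wave vectors). -/
abbrev Plane := EuclideanSpace ℝ (Fin 2)

/-- The Euclidean group `E(2)`: all isometries of the plane, under composition. -/
abbrev E2 := Plane ≃ᵃⁱ[ℝ] Plane

/-- A linear bijection of the plane that preserves the norm, as an element of `E(2)`. -/
noncomputable def ofMaps (f g : Plane →ₗ[ℝ] Plane) (hfg : f ∘ₗ g = LinearMap.id)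
    (hgf : g ∘ₗ f = LinearMap.id) (hf : ∀ x, ‖f x‖ = ‖x‖) : E2 :=
  LinearIsometryEquiv.toAffineIsometryEquiv
    { toLinearEquiv := LinearEquiv.ofLinearMap f g hfg hgf
      norm_map' := hf }

/-- The linear map with matrix `((cos θ, -sin θ), (sin θ, cos θ))`. -/
noncomputable def rotLin (θ : ℝ) : Plane →ₗ[ℝ] Plane where
  toFun x := !₂[Real.cos θ * x 0 - Real.sin θ * x 1, Real.sin θ * x 0 + Real.cos θ * x 1]
  map_add' x y := by ext i; fin_cases i <;> simp <;> ring
  map_smul' c x := by ext i; fin_cases i <;> simp <;> ring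

theorem rotLin_comp_neg (θ : ℝ) : rotLin θ ∘ₗ rotLin (-θ) = LinearMap.id := by
  ext x i
  have h := Real.sin_sq_add_cos_sq θ
  fin_cases i
  · simp [rotLin]; linear_combination (x 0) * h
  · simp [rotLin]; linear_combination (x 1) * h

theorem norm_rotLin (θ : ℝ) (x : Plane) : ‖rotLin θ x‖ = ‖x‖ := by
  have h := Real.sin_sq_add_cos_sq θ
  rw [EuclideanSpace.norm_eq, EuclideanSpace.norm_eq]
  congr 1
  simp [rotLin, Fin.sum_univ_two]
  linear_combination ((x 0) ^ 2 + (x 1) ^ 2) * h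

/-- The rotation `R_θ` about the origin. -/
noncomputable def rotation (θ : ℝ) : E2 :=
  ofMaps (rotLin θ) (rotLin (-θ)) (rotLin_comp_neg θ)
    (by simpa using rotLin_comp_neg (-θ)) (norm_rotLin θ)

/-- `(x, y) ↦ (-x, y)` as a linear map. -/
noncomputable def reflXLin : Plane →ₗ[ℝ] Plane where
  toFun x := !₂[-x 0, x 1]
  map_add' x y := by ext i; fin_cases i <;> simp [add_comm]
  map_smul' c x := by ext i; fin_cases i <;> simp

/-- `(x, y) ↦ (y, x)` as a linear map. -/
noncomputable def reflDiagLin : Plane →ₗ[ℝ] Plane where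
  toFun x := !₂[x 1, x 0]
  map_add' x y := by ext i; fin_cases i <;> simp
  map_smul' c x := by ext i; fin_cases i <;> simp

/-- The reflection `γ₁ : (x, y) ↦ (-x, y)`. -/
noncomputable def reflX : E2 :=
  ofMaps reflXLin reflXLin (by ext x i; fin_cases i <;> simp [reflXLin])
    (by ext x i; fin_cases i <;> simp [reflXLin])
    (fun x => by simp [EuclideanSpace.norm_eq, reflXLin, Fin.sum_univ_two])

/-- The diagonal reflection `γ₂ : (x, y) ↦ (y, x)`. -/
noncomputable def reflDiag : E2 :=
  ofMaps reflDiagLin reflDiagLin (by ext x i; fin_cases i <;> simp [reflDiagLin])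
    (by ext x i; fin_cases i <;> simp [reflDiagLin])
    (fun x => by simp [EuclideanSpace.norm_eq, reflDiagLin, Fin.sum_univ_two, add_comm])

/-- The translation `T_(a,b) : (x, y) ↦ (x + a, y + b)`. -/
noncomputable def translation (a b : ℝ) : E2 :=
  AffineIsometryEquiv.constVAdd ℝ Plane (!₂[a, b] : Plane)

theorem rotation_apply (θ : ℝ) (x : Plane) :
    rotation θ x =
      !₂[Real.cos θ * x 0 - Real.sin θ * x 1, Real.sin θ * x 0 + Real.cos θ * x 1] := rfl

theorem reflX_apply (x : Plane) : reflX x = !₂[-x 0, x 1] := rfl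

theorem reflDiag_apply (x : Plane) : reflDiag x = !₂[x 1, x 0] := rfl

theorem translation_apply (a b : ℝ) (x : Plane) :
    translation a b x = !₂[x 0 + a, x 1 + b] := by
  ext i; fin_cases i <;> simp [translation, add_comm]

theorem rotation_mul_neg (θ : ℝ) : rotation θ * rotation (-θ) = 1 := by
  ext x : 1
  exact LinearMap.congr_fun (rotLin_comp_neg θ) x

/-- The subgroup `D₄ ∔ T²` of `E(2)`, generated by the reflections `γ₁`, `γ₂` and all
translations. (Translations by `2π` along the axes act trivially on periodic fields.) -/
noncomputable def D4T2 : Subgroup E2 :=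
  Subgroup.closure ({reflX, reflDiag} ∪ Set.range fun v : ℝ × ℝ => translation v.1 v.2)

/-- The circle `A(κ)` of wave vectors of length `κ`. -/
abbrev WaveCircle (κ : ℝ) := Metric.sphere (0 : Plane) κ

/-- The amplitudes `a(k)`, `k ∈ A(κ)`, with finite norm `∑ |a(k)|`, of real fields
`Φ(r) = ∑ a(k) exp(i k·r)`; that `Φ` is real means `a(-k) = conj (a(k))`. -/
noncomputable def critSubmodule (κ : ℝ) : Submodule ℝ (lp (fun _ : WaveCircle κ => ℂ) 1) where
  carrier := {a | ∀ k, a (-k) = (starRingEnd ℂ) (a k)}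
  add_mem' {a b} ha hb k := by simp [ha k, hb k]
  zero_mem' k := by simp
  smul_mem' c a ha k := by simp [ha k]

/-- The irreducible center subspace `E^κ(ℝ²)`, with the norm `∑ |a(k)|`. -/
abbrev Crit (κ : ℝ) := ↥(critSubmodule κ)

/-- The amplitude `a(k)` of `Φ` at the wave vector `k`. -/
noncomputable def amp {κ : ℝ} (Φ : Crit κ) (k : WaveCircle κ) : ℂ := Φ.1 k

/-- The field `Φ(r) = ∑ a(k) exp(i k·r)` with the given amplitudes. -/
noncomputable def waveField {κ : ℝ} (Φ : Crit κ) (r : Plane) : ℂ :=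
  ∑' k : WaveCircle κ, amp Φ k * Complex.exp (Complex.I * (inner ℝ k.1 r : ℝ))

/-- The action of the linear part of `γ ∈ E(2)` on the wave vectors of length `κ`. -/
noncomputable def rotWave {κ : ℝ} (γ : E2) : WaveCircle κ ≃ WaveCircle κ where
  toFun k := ⟨γ.linearIsometryEquiv k.1, by simp⟩
  invFun k := ⟨γ.linearIsometryEquiv.symm k.1, by simp⟩
  left_inv k := by simp
  right_inv k := by simp

/-- The phase `exp(-i k·b)`, where `b = γ(0)` is the translation part of `γ`. -/
noncomputable def phase {κ : ℝ} (γ : E2) (k : WaveCircle κ) : ℂ :=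
  Complex.exp (-(Complex.I * (inner ℝ k.1 (γ 0) : ℝ)))

theorem norm_phase {κ : ℝ} (γ : E2) (k : WaveCircle κ) : ‖phase γ k‖ = 1 := by
  simp [phase, Complex.norm_exp]

theorem memlp_act {κ : ℝ} (γ : E2) (Φ : Crit κ) :
    Memℓp (fun k : WaveCircle κ => phase γ k * amp Φ ((rotWave γ).symm k)) 1 := by
  have h := (memℓp_gen_iff (p := 1) (by simp)).1 (lp.memℓp Φ.1)
  refine (memℓp_gen_iff (p := 1) (by simp)).2 ?_
  simpa [norm_phase, amp, Function.comp_def] using (rotWave γ).symm.summable_iff.2 h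

/-- `γ = T_b g` with `g ∈ O(2)` sends the mode `exp(i k·r)` to `exp(-i gk·b) exp(i gk·r)`;
on amplitudes, `(γ·a)(k) = exp(-i k·b) a(g⁻¹k)`. -/
noncomputable instance {κ : ℝ} : SMul E2 (Crit κ) where
  smul γ Φ := ⟨⟨fun k => phase γ k * amp Φ ((rotWave γ).symm k), memlp_act γ Φ⟩, by
    intro k
    have h1 : (rotWave γ).symm (-k) = -(rotWave γ).symm k := by
      ext1; simp [rotWave]
    have h2 : phase γ (-k) = (starRingEnd ℂ) (phase γ k) := by
      simp [phase, ← Complex.exp_conj]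
    have h3 := Φ.2 ((rotWave γ).symm k)
    simp only [map_mul, h1, h2]
    congr 1⟩

theorem amp_smul {κ : ℝ} (γ : E2) (Φ : Crit κ) (k : WaveCircle κ) :
    amp (γ • Φ) k = phase γ k * amp Φ ((rotWave γ).symm k) := rfl

theorem amp_ext {κ : ℝ} {Φ Ψ : Crit κ} (h : ∀ k, amp Φ k = amp Ψ k) : Φ = Ψ :=
  Subtype.ext (lp.ext (funext h))

theorem apply_eq (γ : E2) (x : Plane) : γ x = γ.linearIsometryEquiv x + γ 0 := by
  simpa using γ.map_vadd 0 x

noncomputable instance {κ : ℝ} : MulAction E2 (Crit κ) where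
  one_smul Φ := amp_ext fun k => by
    have h : (rotWave (1 : E2)).symm k = k := by rw [Equiv.symm_apply_eq]; rfl
    have h0 : (1 : E2) (0 : Plane) = 0 := rfl
    simp [amp_smul, h, phase, h0]
  mul_smul γ δ Φ := amp_ext fun k => by
    have h : (rotWave (γ * δ)).symm k = (rotWave δ).symm ((rotWave γ).symm k) := by
      rw [Equiv.symm_apply_eq]
      ext1
      change k.1 = γ.linearIsometryEquiv (δ.linearIsometryEquiv
        (δ.linearIsometryEquiv.symm (γ.linearIsometryEquiv.symm k.1)))
      simp
    have h0 : (γ * δ) (0 : Plane) = γ.linearIsometryEquiv (δ 0) + γ 0 := apply_eq γ (δ 0)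
    have h1 : inner ℝ k.1 (γ.linearIsometryEquiv (δ 0))
        = inner ℝ ((rotWave γ).symm k).1 (δ 0) := by
      change _ = inner ℝ (γ.linearIsometryEquiv.symm k.1) (δ 0)
      rw [← LinearIsometryEquiv.inner_map_map γ.linearIsometryEquiv
        (γ.linearIsometryEquiv.symm k.1) (δ 0), LinearIsometryEquiv.apply_symm_apply]
    simp only [amp_smul, h, ← mul_assoc]
    congr 1
    simp only [phase, h0, inner_add_right, h1, ← Complex.exp_add]
    congr 1
    push_cast
    ring

/-- On fields the action is the usual one, `(γ·Φ)(r) = Φ(γ⁻¹ r)`. -/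
theorem waveField_smul {κ : ℝ} (γ : E2) (Φ : Crit κ) (r : Plane) :
    waveField (γ • Φ) r = waveField Φ (γ⁻¹ r) := by
  unfold waveField
  rw [← (rotWave γ).tsum_eq]
  refine tsum_congr fun k => ?_
  have hr : r = γ.linearIsometryEquiv (γ⁻¹ r) + γ 0 := by
    rw [← apply_eq]; exact (γ.apply_symm_apply r).symm
  have h : inner ℝ (rotWave γ k).1 r = inner ℝ k.1 (γ⁻¹ r) + inner ℝ (rotWave γ k).1 (γ 0) := by
    conv_lhs => rw [hr, inner_add_right]
    congr 1
    exact LinearIsometryEquiv.inner_map_map γ.linearIsometryEquiv _ _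
  rw [amp_smul, Equiv.symm_apply_apply, phase, h, mul_right_comm, mul_comm, ← Complex.exp_add]
  congr 2
  push_cast
  ring

theorem amp_translation_smul {κ : ℝ} (a b : ℝ) (Φ : Crit κ) (k : WaveCircle κ) :
    amp (translation a b • Φ) k =
      Complex.exp (-(Complex.I * ((k.1 0 * a + k.1 1 * b : ℝ) : ℂ))) * amp Φ k := by
  have h : (rotWave (translation a b)).symm k = k := by rw [Equiv.symm_apply_eq]; rfl
  have h0 : translation a b 0 = !₂[a, b] := by simp [translation_apply]
  rw [amp_smul, h, phase, h0]
  congr 5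
  simp [PiLp.inner_apply, Fin.sum_univ_two, mul_comm]

/-- `E^c(Ω̃)`, the critical modes with periodic boundary conditions on `[-π, π]²`: the fields
in `E^κ(ℝ²)` that are invariant under the translations by `2π` along the axes. -/
noncomputable def periodicSpace (κ : ℝ) : Submodule ℝ (Crit κ) where
  carrier := {Φ | translation (2 * Real.pi) 0 • Φ = Φ ∧ translation 0 (2 * Real.pi) • Φ = Φ}
  add_mem' {Φ Ψ} hΦ hΨ := by
    have add : ∀ γ : E2, γ • (Φ + Ψ) = γ • Φ + γ • Ψ := fun γ => amp_ext fun k => by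
      simp only [amp_smul]
      exact mul_add _ _ _
    exact ⟨by rw [add, hΦ.1, hΨ.1], by rw [add, hΦ.2, hΨ.2]⟩
  zero_mem' := by
    have zero : ∀ γ : E2, γ • (0 : Crit κ) = 0 := fun γ => amp_ext fun k => by
      rw [amp_smul]
      exact mul_zero _
    exact ⟨zero _, zero _⟩
  smul_mem' c Φ hΦ := by
    have sm : ∀ γ : E2, γ • (c • Φ) = c • γ • Φ := fun γ => amp_ext fun k => by
      simp only [amp_smul]
      exact mul_smul_comm c _ _
    exact ⟨by rw [sm, hΦ.1], by rw [sm, hΦ.2]⟩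

theorem mem_periodicSpace {κ : ℝ} {Φ : Crit κ} : Φ ∈ periodicSpace κ ↔
    translation (2 * Real.pi) 0 • Φ = Φ ∧ translation 0 (2 * Real.pi) • Φ = Φ := Iff.rfl

/-- `V_{l,n}`: the real fields that are superpositions of the modes `exp(i k·r)` with
`k ∈ {±(l,n), ±(l,-n), ±(n,l), ±(n,-l)}`. It is four-dimensional for `l = n > 0` and for
`l > n = 0`, and eight-dimensional for `l > n > 0`, when `κ² = l² + n²`. -/
noncomputable def irrep (κ : ℝ) (l n : ℕ) : Submodule ℝ (Crit κ) where
  carrier := {Φ | ∀ k : WaveCircle κ, amp Φ k ≠ 0 →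
    (|k.1 0| = l ∧ |k.1 1| = n) ∨ (|k.1 0| = n ∧ |k.1 1| = l)}
  add_mem' {Φ Ψ} hΦ hΨ k hk := by
    by_cases h : amp Φ k = 0
    · refine hΨ k fun h' => hk ?_
      change amp Φ k + amp Ψ k = 0
      simp [h, h']
    · exact hΦ k h
  zero_mem' k hk := absurd rfl hk
  smul_mem' c Φ hΦ k hk := by
    refine hΦ k fun h => hk ?_
    change c • amp Φ k = 0
    simp [h]

/-- `D₄ ∔ T²` acts on `E^c(Ω̃)`. -/
theorem smul_mem_periodicSpace_iff {κ : ℝ} {γ : E2} (hγ : γ ∈ D4T2) (Φ : Crit κ) :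
    γ • Φ ∈ periodicSpace κ ↔ Φ ∈ periodicSpace κ := by
  induction hγ using Subgroup.closure_induction generalizing Φ with
  | one => rw [one_smul]
  | mul x y _ _ hx hy => rw [mul_smul, hx, hy]
  | inv x _ hx => rw [← hx (x⁻¹ • Φ), smul_inv_smul]
  | mem x hx =>
    have key : ∀ s t : E2, s * x = x * t → (s • x • Φ = x • Φ ↔ t • Φ = Φ) := fun s t h => by
      rw [← mul_smul, h, mul_smul, smul_left_cancel_iff]
    have neg : translation (-(2 * Real.pi)) 0 = (translation (2 * Real.pi) 0)⁻¹ := by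
      rw [eq_inv_iff_mul_eq_one]
      ext y i
      change translation _ _ (translation _ _ y) i = y i
      fin_cases i <;> simp [translation_apply]
    rw [mem_periodicSpace, mem_periodicSpace]
    rcases hx with (rfl | rfl) | ⟨v, rfl⟩
    · rw [key _ (translation (-(2 * Real.pi)) 0), key _ (translation 0 (2 * Real.pi)), neg,
        inv_smul_eq_iff, eq_comm (a := Φ)]
      all_goals
        ext y i
        change translation _ _ (reflX y) i = reflX (translation _ _ y) i
        fin_cases i <;> simp [translation_apply, reflX_apply, add_comm]
    · rw [key _ (translation 0 (2 * Real.pi)), key _ (translation (2 * Real.pi) 0), and_comm]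
      all_goals
        ext y i
        change translation _ _ (reflDiag y) i = reflDiag (translation _ _ y) i
        fin_cases i <;> simp [translation_apply, reflDiag_apply]
    · rw [key _ (translation (2 * Real.pi) 0), key _ (translation 0 (2 * Real.pi))]
      all_goals
        ext y i
        change translation _ _ (translation _ _ y) i = translation _ _ (translation _ _ y) i
        fin_cases i <;> simp [translation_apply, add_right_comm]

theorem smul_mem_periodicSpace {κ : ℝ} {γ : E2} (hγ : γ ∈ D4T2) {Φ : Crit κ}
    (hΦ : Φ ∈ periodicSpace κ) : γ • Φ ∈ periodicSpace κ :=
  (smul_mem_periodicSpace_iff hγ Φ).2 hΦ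

/-- If `Φ` lies in `R_{-θ} E^c(Ω̃)` then `R_θ Φ` lies in `E^c(Ω̃)`. -/
theorem rotation_smul_mem {κ θ : ℝ} {Φ : Crit κ}
    (hΦ : Φ ∈ rotation (-θ) • (periodicSpace κ : Set (Crit κ))) :
    rotation θ • Φ ∈ periodicSpace κ := by
  obtain ⟨Ψ, hΨ, rfl⟩ := hΦ
  simpa [← mul_smul, rotation_mul_neg] using hΨ

/-- A smooth vector field on a real normed space that is homogeneous of degree `p`. -/
def IsHomogeneousField {E : Type*} [NormedAddCommGroup E] [NormedSpace ℝ E] (p : ℕ)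
    (F : E → E) : Prop :=
  ContDiff ℝ ∞ F ∧ ∀ (c : ℝ) (Φ : E), F (c • Φ) = c ^ p • F Φ

/-- `D₄ ∔ T²`-equivariance of a vector field on `E^c(Ω̃)`. -/
def IsD4T2Equivariant {κ : ℝ} (F : periodicSpace κ → periodicSpace κ) : Prop :=
  ∀ (γ : E2) (hγ : γ ∈ D4T2) (Φ : periodicSpace κ),
    γ • (F Φ : Crit κ) = F ⟨γ • (Φ : Crit κ), smul_mem_periodicSpace hγ Φ.2⟩

/-- `E(2)`-equivariance of a vector field on `E^κ(ℝ²)`. -/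
def IsE2Equivariant {κ : ℝ} (F : Crit κ → Crit κ) : Prop :=
  ∀ (γ : E2) (Φ : Crit κ), γ • F Φ = F (γ • Φ)

end EuclideanModes

open EuclideanModes

namespace EuclideanModes

/-! That 1 implies 2 is equivariance under rotations. For the converse, a smooth field homogeneous
of degree `p` is the diagonal of a `p`-linear form, its `p`-th derivative at 0 divided by `p!`
(`polar`), and so a finite sum over `p`-tuples of lattice modes `±k`. Take any tuple of wave vectors
on the circle. If some isometry γ carries all its modes into the lattice, equivariance dictates a
value there: move by γ, apply the polar form, move back. Two choices of γ differ by an isometry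
taking periodic fields to periodic fields, and condition 2, extended to all isometries
(`IsRotationCompatible.smul_eq`) and to the polar form (`smul_polar`), makes them agree
(`interaction_apply`). Tuples that no isometry straightens form an invariant set, where the value 0
is consistent.

The group permutes the tuples, so the sum of all interactions is equivariant. Isometries preserve
the norm, so each term is at most the norm of the polar form times the product of the amplitudes. In
the ℓ¹ norm these bounds are summable, hence the sum is a bounded `p`-linear map with smooth
diagonal. On periodic fields only lattice tuples contribute, γ = 1 straightens them, and the given
field comes back (`totalInteraction_of_mem`). -/

/-! ### Factorization of plane isometries through one rotation -/

theorem exists_mul_rotation_mul (γ : E2) :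
    ∃ τ ∈ D4T2, ∃ θ : ℝ, ∃ σ ∈ D4T2, γ = τ * rotation θ * σ := by
  set e : Plane := !₂[1, 0]
  set f : Plane := !₂[0, 1]
  set u := γ.linearIsometryEquiv e
  set v := γ.linearIsometryEquiv f
  have hu : inner ℝ u u = (1 : ℝ) := by
    rw [LinearIsometryEquiv.inner_map_map]; simp [e, EuclideanSpace.norm_eq, Fin.sum_univ_two]
  have hv : inner ℝ v v = (1 : ℝ) := by
    rw [LinearIsometryEquiv.inner_map_map]; simp [f, EuclideanSpace.norm_eq, Fin.sum_univ_two]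
  have huv : inner ℝ u v = (0 : ℝ) := by
    rw [LinearIsometryEquiv.inner_map_map]; simp [e, f, PiLp.inner_apply, Fin.sum_univ_two]
  simp only [PiLp.inner_apply, Fin.sum_univ_two, RCLike.inner_apply, conj_trivial] at hu hv huv
  have hγ (x : Plane) (i : Fin 2) : γ x i = x 0 * u i + x 1 * v i + γ 0 i := by
    have hx : x = x 0 • e + x 1 • f := by ext i; fin_cases i <;> simp [e, f]
    rw [apply_eq]
    conv_lhs => rw [hx]
    rw [map_add, map_smul, map_smul]
    rfl
  have hT : translation (γ 0 0) (γ 0 1) ∈ D4T2 :=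
    Subgroup.subset_closure (Or.inr ⟨(γ 0 0, γ 0 1), rfl⟩)
  have hX : reflX ∈ D4T2 := Subgroup.subset_closure (Or.inl (Or.inl rfl))
  -- The columns of the linear part are orthonormal, so the determinant squares to 1; its sign
  -- decides whether `v` is the quarter turn of `u` or the opposite vector.
  have hdet : (v 0 = -u 1 ∧ v 1 = u 0) ∨ (v 0 = u 1 ∧ v 1 = -u 0) := by
    have h : (u 0 * v 1 - u 1 * v 0) ^ 2 = 1 := by
      linear_combination (v 0 * v 0 + v 1 * v 1) * hu + hv - (v 0 * u 0 + v 1 * u 1) * huv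
    rcases eq_or_eq_neg_of_sq_eq_sq _ 1 (h.trans (one_pow 2).symm) with h | h
    · left
      constructor
      · linear_combination (-v 0) * hu + u 0 * huv - u 1 * h
      · linear_combination (-v 1) * hu + u 1 * huv + u 0 * h
    · right
      constructor
      · linear_combination (-v 0) * hu + u 0 * huv - u 1 * h
      · linear_combination (-v 1) * hu + u 1 * huv + u 0 * h
  have htrig (a b : ℝ) (h : a * a + b * b = 1) : ∃ θ : ℝ, Real.cos θ = a ∧ Real.sin θ = b := by
    have hz : ‖(⟨a, b⟩ : ℂ)‖ = 1 := by
      rw [← sq_eq_sq₀ (norm_nonneg _) zero_le_one, Complex.sq_norm, Complex.normSq_mk, h, one_pow]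
    refine ⟨Complex.arg ⟨a, b⟩, ?_, ?_⟩
    · rw [Complex.cos_arg (by intro h0; simp [h0] at hz), hz, div_one]
    · rw [Complex.sin_arg, hz, div_one]
  rcases hdet with ⟨h0, h1⟩ | ⟨h0, h1⟩
  · obtain ⟨θ, hc, hs⟩ := htrig (u 0) (u 1) hu
    refine ⟨_, hT, θ, 1, one_mem _, ?_⟩
    ext x i
    change γ x i = translation _ _ (rotation θ x) i
    rw [hγ, translation_apply, rotation_apply, hc, hs]
    fin_cases i
    · simp [h0]; ring
    · simp [h1]; ring
  -- Since γ₁ sends `e` to `-e`, the rotation has to send `e` to `-u`.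
  · obtain ⟨θ, hc, hs⟩ := htrig (-u 0) (-u 1) (by linarith)
    refine ⟨_, hT, θ, reflX, hX, ?_⟩
    ext x i
    change γ x i = translation _ _ (rotation θ (reflX x)) i
    rw [hγ, translation_apply, rotation_apply, reflX_apply, hc, hs]
    fin_cases i
    · simp [h0]; ring
    · simp [h1]; ring

/-! ### Derivatives of homogeneous maps, and sums over tuples -/

/-- Along the line through `x` the map is `t ↦ t ^ p • F x`, and only the `p`-th derivative of this
monomial is needed. -/
theorem iteratedFDeriv_of_homogeneous {E G : Type*} [NormedAddCommGroup E] [NormedSpace ℝ E]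
    [NormedAddCommGroup G] [NormedSpace ℝ G] {p : ℕ} {F : E → G} (hF : ContDiff ℝ ∞ F)
    (hom : ∀ (c : ℝ) (x : E), F (c • x) = c ^ p • F x) (x : E) :
    iteratedFDeriv ℝ p F 0 (fun _ => x) = (p.factorial : ℝ) • F x := by
  have hp : (p : WithTop ℕ∞) ≤ ∞ := by exact_mod_cast le_top
  have h1 := ContinuousLinearMap.iteratedFDeriv_comp_right
    (ContinuousLinearMap.toSpanSingleton ℝ x) hF 0 hp
  have h2 := ContinuousLinearMap.iteratedFDeriv_comp_left
    (ContinuousLinearMap.toSpanSingleton ℝ (F x)) (f := fun t : ℝ => t ^ p) (x := 0) (i := p)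
    (n := ∞) (by fun_prop) hp
  have h3 : F ∘ ContinuousLinearMap.toSpanSingleton ℝ x =
      ContinuousLinearMap.toSpanSingleton ℝ (F x) ∘ fun t : ℝ => t ^ p := by
    ext t; simp [hom]
  rw [← h3, h1] at h2
  have h4 := congrArg (fun M => M fun _ => (1 : ℝ)) h2
  simp only [ContinuousMultilinearMap.compContinuousLinearMap_apply, map_zero,
    ContinuousLinearMap.compContinuousMultilinearMap_coe, Function.comp_apply,
    ContinuousLinearMap.toSpanSingleton_apply, one_smul, ← iteratedDeriv_eq_iteratedFDeriv] at h4
  rw [h4, iteratedDeriv_fun_pow_zero]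
  simp

theorem IsHomogeneousField.comp_projection {E : Type*} [NormedAddCommGroup E] [NormedSpace ℝ E]
    {p : ℕ} {W : Submodule ℝ E} {F : W → W} (hF : IsHomogeneousField p F) (Q : E →L[ℝ] W) :
    IsHomogeneousField p fun x => (F (Q x) : E) := by
  refine ⟨W.subtypeL.contDiff.comp (hF.1.comp Q.contDiff), fun c x => ?_⟩
  simp only [map_smul, hF.2, Submodule.coe_smul]

/-- The commutation is known only on `W`, which `L` need not preserve. It is an identity between two
maps defined on `W`; differentiating it `p` times at 0, with the chain rule for linear maps, gives
the claim for directions in `W`. -/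
theorem map_iteratedFDeriv_of_commute {E : Type*} [NormedAddCommGroup E] [NormedSpace ℝ E]
    {H : E → E} (hH : ContDiff ℝ ∞ H) (L : E →L[ℝ] E) (W : Submodule ℝ E)
    (hW : ∀ x ∈ W, L (H x) = H (L x)) {p : ℕ} {m : Fin p → E} (hm : ∀ i, m i ∈ W) :
    L (iteratedFDeriv ℝ p H 0 m) = iteratedFDeriv ℝ p H 0 fun i => L (m i) := by
  have hcomp : L ∘ (H ∘ W.subtypeL) = H ∘ (L.comp W.subtypeL) := funext fun w => hW w.1 w.2
  have hp : (p : WithTop ℕ∞) ≤ ∞ := by exact_mod_cast le_top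
  have h1 := L.iteratedFDeriv_comp_left (x := 0) (hH.comp W.subtypeL.contDiff).contDiffAt hp
  rw [hcomp, ContinuousLinearMap.iteratedFDeriv_comp_right _ hH _ hp,
    ContinuousLinearMap.iteratedFDeriv_comp_right _ hH _ hp] at h1
  have h2 := congrArg (fun M => M fun i => (⟨m i, hm i⟩ : W)) h1
  simp only [map_zero] at h2
  exact h2.symm

/-- A finite set of tuples lies in the box of its coordinate projections, over which the sum of
products factors. This bounds all partial sums at once. -/
theorem summable_tsum_le_prod_norm {ι A : Type*} [Fintype ι] (f : ι → A → ℝ)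
    (h0 : ∀ i a, 0 ≤ f i a) (hf : ∀ i, Summable (f i)) :
    Summable (fun r : ι → A => ∏ i, f i (r i)) ∧
      ∑' r : ι → A, ∏ i, f i (r i) ≤ ∏ i, ∑' a, f i a := by
  classical
  have hnn (r : ι → A) : 0 ≤ ∏ i, f i (r i) := Finset.prod_nonneg fun i _ => h0 i _
  have hb (s : Finset (ι → A)) : ∑ r ∈ s, ∏ i, f i (r i) ≤ ∏ i, ∑' a, f i a := by
    calc ∑ r ∈ s, ∏ i, f i (r i)
        ≤ ∑ r ∈ Fintype.piFinset fun i => s.image fun r => r i, ∏ i, f i (r i) :=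
          Finset.sum_le_sum_of_subset_of_nonneg
            (fun r hr => Fintype.mem_piFinset.2 fun i => Finset.mem_image_of_mem _ hr)
            fun r _ _ => hnn r
      _ = ∏ i, ∑ a ∈ s.image fun r => r i, f i a := (Finset.prod_univ_sum _ _).symm
      _ ≤ ∏ i, ∑' a, f i a := Finset.prod_le_prod
          (fun i _ => Finset.sum_nonneg fun a _ => h0 i a)
          fun i _ => (hf i).sum_le_tsum _ fun a _ => h0 i a
  have hs := summable_of_sum_le hnn hb
  exact ⟨hs, hs.tsum_le_of_sum_le hb⟩

/-! ### Amplitudes, the ℓ¹ norm and the isometric action -/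

variable {κ : ℝ} {p : ℕ}

theorem norm_crit (Φ : Crit κ) : ‖Φ‖ = ∑' k, ‖amp Φ k‖ := by
  change ‖Φ.1‖ = _
  rw [lp.norm_eq_tsum_rpow (by simp)]
  simp [amp]

theorem summable_norm_amp (Φ : Crit κ) : Summable fun k => ‖amp Φ k‖ := by
  simpa [amp] using (memℓp_gen_iff (p := 1) (by simp)).1 (lp.memℓp Φ.1)

theorem amp_add (Φ Ψ : Crit κ) (k : WaveCircle κ) : amp (Φ + Ψ) k = amp Φ k + amp Ψ k := rfl

theorem amp_real_smul (c : ℝ) (Φ : Crit κ) (k : WaveCircle κ) : amp (c • Φ) k = c * amp Φ k := rfl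

theorem amp_neg (Φ : Crit κ) (k : WaveCircle κ) : amp Φ (-k) = (starRingEnd ℂ) (amp Φ k) := Φ.2 k

/-- The amplitude at `k` as a continuous linear functional. -/
noncomputable def ampL (k : WaveCircle κ) : Crit κ →L[ℝ] ℂ :=
  (lp.evalCLM ℝ (fun _ : WaveCircle κ => ℂ) (p := 1) k).comp (critSubmodule κ).subtypeL

theorem ampL_apply (k : WaveCircle κ) (Φ : Crit κ) : ampL k Φ = amp Φ k := rfl

/-- Reality is a family of closed conditions on ℓ¹. Completeness makes the norm-bounded series of
interactions converge. -/
instance : CompleteSpace (Crit κ) := by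
  have h : (critSubmodule κ : Set (lp (fun _ : WaveCircle κ => ℂ) 1)) =
      ⋂ k, {a | a (-k) = (starRingEnd ℂ) (a k)} := by
    ext a; simp [critSubmodule]
  refine IsClosed.completeSpace_coe (hs := ?_)
  rw [h]
  refine isClosed_iInter fun k => isClosed_eq ?_ ?_
  · exact (lp.evalCLM ℝ (fun _ : WaveCircle κ => ℂ) (p := 1) (-k)).continuous
  · exact Complex.continuous_conj.comp
      (lp.evalCLM ℝ (fun _ : WaveCircle κ => ℂ) (p := 1) k).continuous

theorem norm_smul_crit (γ : E2) (Φ : Crit κ) : ‖γ • Φ‖ = ‖Φ‖ := by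
  rw [norm_crit, norm_crit, ← (rotWave γ).symm.tsum_eq fun k => ‖amp Φ k‖]
  simp [amp_smul, norm_phase]

/-- The action of `γ ∈ E(2)` as a continuous linear map. -/
noncomputable def actL (γ : E2) : Crit κ →L[ℝ] Crit κ :=
  LinearMap.mkContinuous
    { toFun := fun Φ => γ • Φ
      map_add' := fun Φ Ψ => amp_ext fun k => by
        simp only [amp_smul, amp_add, mul_add]
      map_smul' := fun c Φ => amp_ext fun k => by
        simp only [amp_smul, amp_real_smul, RingHom.id_apply]; ring }
    1 fun Φ => by rw [one_mul]; exact (norm_smul_crit γ Φ).le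

theorem actL_apply (γ : E2) (Φ : Crit κ) : actL γ Φ = γ • Φ := rfl

/-- Multiplication of the amplitudes by an even real weight of absolute value at most one. -/
noncomputable def weighted (w : WaveCircle κ → ℝ) (hw : ∀ k, w (-k) = w k)
    (hb : ∀ k, |w k| ≤ 1) : Crit κ →ₗ[ℝ] Crit κ where
  toFun Φ := ⟨⟨fun k => w k * amp Φ k, by
      refine (memℓp_gen_iff (p := 1) (by simp)).2 ?_
      simp only [ENNReal.toReal_one, Real.rpow_one, norm_mul, Complex.norm_real, Real.norm_eq_abs]
      exact Summable.of_nonneg_of_le (fun k => by positivity)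
        (fun k => mul_le_of_le_one_left (norm_nonneg _) (hb k)) (summable_norm_amp Φ)⟩, by
    intro k
    change (w (-k) : ℂ) * amp Φ (-k) = (starRingEnd ℂ) (w k * amp Φ k)
    rw [hw, amp_neg, map_mul, Complex.conj_ofReal]⟩
  map_add' Φ Ψ := amp_ext fun k => mul_add _ _ _
  map_smul' c Φ := amp_ext fun k => mul_left_comm _ _ _

theorem amp_weighted {w : WaveCircle κ → ℝ} {hw : ∀ k, w (-k) = w k} {hb : ∀ k, |w k| ≤ 1}
    (Φ : Crit κ) (k : WaveCircle κ) : amp (weighted w hw hb Φ) k = w k * amp Φ k := rfl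

theorem norm_weighted_le {w : WaveCircle κ → ℝ} {hw : ∀ k, w (-k) = w k} {hb : ∀ k, |w k| ≤ 1}
    (Φ : Crit κ) : ‖weighted w hw hb Φ‖ ≤ ‖Φ‖ := by
  rw [norm_crit, norm_crit]
  refine Summable.tsum_le_tsum (fun k => ?_) (summable_norm_amp _) (summable_norm_amp _)
  rw [amp_weighted, norm_mul, Complex.norm_real]
  exact mul_le_of_le_one_left (norm_nonneg _) (hb k)

/-! ### Lattice wave vectors and mode projections -/

/-- The wave vectors with integer coordinates. -/
def latticeWaves (κ : ℝ) : Set (WaveCircle κ) := {k | ∀ i, ∃ m : ℤ, k.1 i = m}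

theorem neg_mem_latticeWaves {k : WaveCircle κ} : -k ∈ latticeWaves κ ↔ k ∈ latticeWaves κ := by
  refine forall_congr' fun i => ⟨fun ⟨m, hm⟩ => ⟨-m, ?_⟩, fun ⟨m, hm⟩ => ⟨-m, ?_⟩⟩
  · have : -(k.1 i) = m := hm
    push_cast; linarith
  · change -(k.1 i) = _
    rw [hm]; push_cast; rfl

theorem abs_apply_le (k : WaveCircle κ) (i : Fin 2) : |k.1 i| ≤ κ := by
  have h : ‖k.1‖ = κ := by simp
  exact (PiLp.norm_apply_le k.1 i).trans h.le

theorem finite_latticeWaves : (latticeWaves κ).Finite := by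
  have hbox : (Set.univ.pi fun _ : Fin 2 => ((Int.cast : ℤ → ℝ) '' Set.Icc (-⌈κ⌉) ⌈κ⌉)).Finite :=
    Set.Finite.pi fun _ => (Set.finite_Icc _ _).image _
  refine Set.Finite.of_finite_image (f := fun k : WaveCircle κ => (k.1 : Fin 2 → ℝ))
    (hbox.subset ?_) ?_
  · rintro _ ⟨k, hk, rfl⟩ i -
    obtain ⟨m, hm⟩ := hk i
    have h := abs_le.1 (abs_apply_le k i)
    have hc := Int.le_ceil κ
    rw [hm] at h
    refine ⟨m, ⟨?_, ?_⟩, hm.symm⟩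
    · have : (-⌈κ⌉ : ℝ) ≤ m := by linarith
      exact_mod_cast this
    · have : (m : ℝ) ≤ ⌈κ⌉ := by linarith
      exact_mod_cast this
  · intro k _ l _ h
    ext i
    exact congrFun h i

theorem exp_two_pi_eq_one_iff (x : ℝ) :
    Complex.exp (-(Complex.I * ((x * (2 * Real.pi) : ℝ) : ℂ))) = 1 ↔ ∃ m : ℤ, x = m := by
  rw [Complex.exp_neg, inv_eq_one, Complex.exp_eq_one_iff]
  refine exists_congr fun m => ?_
  have hI : Complex.I * ((x * (2 * Real.pi) : ℝ) : ℂ) = x * (2 * Real.pi * Complex.I) := by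
    push_cast; ring
  rw [hI, mul_left_inj' Complex.two_pi_I_ne_zero]
  norm_cast

/-- Translation by 2π along an axis multiplies `a(k)` by `exp(-2πi kⱼ)`, which is 1 exactly when the
coordinate `kⱼ` is an integer. -/
theorem mem_periodicSpace_iff_amp {Φ : Crit κ} :
    Φ ∈ periodicSpace κ ↔ ∀ k, amp Φ k ≠ 0 → k ∈ latticeWaves κ := by
  have h (a b : ℝ) : translation a b • Φ = Φ ↔ ∀ k : WaveCircle κ, amp Φ k ≠ 0 →
      Complex.exp (-(Complex.I * ((k.1 0 * a + k.1 1 * b : ℝ) : ℂ))) = 1 := by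
    refine ⟨fun h k hk => ?_, fun h => amp_ext fun k => ?_⟩
    · have := congrArg (amp · k) h
      simpa only [amp_translation_smul, mul_eq_right₀ hk] using this
    · rw [amp_translation_smul]
      by_cases hk : amp Φ k = 0
      · simp [hk]
      · rw [h k hk, one_mul]
  rw [mem_periodicSpace, h, h]
  simp only [mul_zero, add_zero, zero_add, exp_two_pi_eq_one_iff, latticeWaves, Set.mem_ofPred_eq,
    Fin.forall_fin_two, ← forall_and]

open Classical in
/-- The projection of the fields onto the periodic ones. -/
noncomputable def latticeProj (κ : ℝ) : Crit κ →L[ℝ] periodicSpace κ :=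
  LinearMap.mkContinuous
    ((weighted (fun k => if k ∈ latticeWaves κ then 1 else 0)
      (fun k => by simp only [neg_mem_latticeWaves])
      (fun k => by split_ifs <;> simp)).codRestrict (periodicSpace κ) fun Φ => by
        refine mem_periodicSpace_iff_amp.2 fun k hk => ?_
        by_contra h
        exact hk (by simp [amp_weighted, h]))
    1 fun Φ => by
      rw [one_mul]
      exact norm_weighted_le (hw := fun k => by simp only [neg_mem_latticeWaves])
        (hb := fun k => by split_ifs <;> simp) Φ

theorem latticeProj_of_mem {Φ : Crit κ} (h : Φ ∈ periodicSpace κ) : latticeProj κ Φ = ⟨Φ, h⟩ := by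
  classical
  refine Subtype.ext (amp_ext fun k => ?_)
  change ((if k ∈ latticeWaves κ then (1 : ℝ) else 0 : ℝ) : ℂ) * amp Φ k = amp Φ k
  by_cases hk : amp Φ k = 0
  · simp [hk]
  · simp [mem_periodicSpace_iff_amp.1 h k hk]

open Classical in
/-- Half of the part of a field with wave vectors `±k`. -/
noncomputable def modeProj (k : WaveCircle κ) : Crit κ →ₗ[ℝ] Crit κ :=
  -- Reality forces `k` and `-k` to be kept together. A sum over all `k` meets each such pair twice,
  -- whence the factor one half.
  weighted (fun j => ((if j = k then 1 else 0) + if -j = k then 1 else 0) / 2)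
    (fun j => by simp only [neg_neg, add_comm])
    (fun j => by split_ifs <;> norm_num)

open Classical in
theorem amp_modeProj (k : WaveCircle κ) (Φ : Crit κ) (j : WaveCircle κ) :
    amp (modeProj k Φ) j = ((if j = k then 1 else 0) + if -j = k then 1 else 0) / 2 * amp Φ j := by
  rw [modeProj, amp_weighted]; split_ifs <;> norm_num

theorem amp_modeProj_ne_zero {k : WaveCircle κ} {Φ : Crit κ} {j : WaveCircle κ}
    (h : amp (modeProj k Φ) j ≠ 0) : j = k ∨ -j = k := by
  by_contra! hj
  exact h (by simp [amp_modeProj, hj])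

theorem norm_modeProj_le (k : WaveCircle κ) (Φ : Crit κ) : ‖modeProj k Φ‖ ≤ ‖amp Φ k‖ := by
  classical
  rw [norm_crit]
  have hk : ‖amp Φ (-k)‖ = ‖amp Φ k‖ := by rw [amp_neg, RCLike.norm_conj]
  have h (j : WaveCircle κ) : ‖amp (modeProj k Φ) j‖ =
      (if j = k then ‖amp Φ k‖ / 2 else 0) + if j = -k then ‖amp Φ k‖ / 2 else 0 := by
    have hn : -j = k ↔ j = -k := neg_eq_iff_eq_neg
    simp only [amp_modeProj, hn]
    by_cases h1 : j = k <;> by_cases h2 : j = -k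
    · rw [if_pos h1, if_pos h2, if_pos h1, if_pos h2, h1]; norm_num
    · rw [if_pos h1, if_neg h2, if_pos h1, if_neg h2, h1]; norm_num; ring
    · rw [if_neg h1, if_pos h2, if_neg h1, if_pos h2, h2, norm_mul, hk]; norm_num; ring
    · simp [h1, h2]
  have hs (l : WaveCircle κ) :
      HasSum (fun j => if j = l then ‖amp Φ k‖ / 2 else 0) (‖amp Φ k‖ / 2) :=
    hasSum_ite_eq l _
  have := ((hs k).add (hs (-k))).tsum_eq
  simp only [h, this]
  linarith

/-- `modeProj` as a continuous linear map. -/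
noncomputable def modeProjL (k : WaveCircle κ) : Crit κ →L[ℝ] Crit κ :=
  (modeProj k).mkContinuous 1 fun Φ => by rw [one_mul]; exact norm_weighted_le Φ

theorem modeProj_mem {k : WaveCircle κ} (hk : k ∈ latticeWaves κ) (Φ : Crit κ) :
    modeProj k Φ ∈ periodicSpace κ :=
  mem_periodicSpace_iff_amp.2 fun j hj => by
    rcases amp_modeProj_ne_zero hj with rfl | h
    · exact hk
    · rw [← h] at hk; exact neg_mem_latticeWaves.1 hk

theorem rotWave_symm_neg (γ : E2) (k : WaveCircle κ) :
    (rotWave γ).symm (-k) = -(rotWave γ).symm k := by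
  ext1; simp [rotWave]

theorem smul_modeProj (γ : E2) (k : WaveCircle κ) (Φ : Crit κ) :
    γ • modeProj k Φ = modeProj (rotWave γ k) (γ • Φ) := amp_ext fun j => by
  have h1 : (rotWave γ).symm j = k ↔ j = rotWave γ k := Equiv.symm_apply_eq _
  have h2 : -(rotWave γ).symm j = k ↔ -j = rotWave γ k := by
    rw [← rotWave_symm_neg, Equiv.symm_apply_eq]
  simp only [amp_smul, amp_modeProj, h1, h2]
  ring

theorem sum_modeProj {Φ : Crit κ} (hΦ : Φ ∈ periodicSpace κ) :
    ∑ k ∈ finite_latticeWaves.toFinset, modeProj k Φ = Φ := amp_ext fun j => by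
  classical
  rw [← ampL_apply, map_sum]
  simp only [ampL_apply, amp_modeProj]
  by_cases hj : amp Φ j = 0
  · simp [hj]
  · have h := mem_periodicSpace_iff_amp.1 hΦ j hj
    rw [← Finset.sum_mul, ← Finset.sum_div, Finset.sum_add_distrib]
    simp [h, neg_mem_latticeWaves]

/-! ### From rotations to all isometries, and to the polar form -/

/-- The compatibility of a field on `E^c(Ω̃)` with all rotations. -/
def IsRotationCompatible (F : periodicSpace κ → periodicSpace κ) : Prop :=
  ∀ (θ : ℝ) (Φ : Crit κ) (hΦ : Φ ∈ periodicSpace κ)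
    (hΦθ : Φ ∈ rotation (-θ) • (periodicSpace κ : Set (Crit κ))),
    rotation θ • (F ⟨Φ, hΦ⟩ : Crit κ) = F ⟨rotation θ • Φ, rotation_smul_mem hΦθ⟩

/-- In γ = τ R_θ σ the outer factors preserve periodicity in both directions, so the rotation in the
middle acts between periodic fields and condition 2 applies to it. -/
theorem IsRotationCompatible.smul_eq {F : periodicSpace κ → periodicSpace κ}
    (hF : IsRotationCompatible F) (hFeq : IsD4T2Equivariant F) (γ : E2) {Φ : Crit κ}
    (hΦ : Φ ∈ periodicSpace κ) (hγ : γ • Φ ∈ periodicSpace κ) :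
    γ • (F ⟨Φ, hΦ⟩ : Crit κ) = F ⟨γ • Φ, hγ⟩ := by
  obtain ⟨τ, hτ, θ, σ, hσ, rfl⟩ := exists_mul_rotation_mul γ
  have hσΦ := smul_mem_periodicSpace hσ hΦ
  have hθ : rotation θ • σ • Φ ∈ periodicSpace κ := by
    rw [mul_smul, mul_smul] at hγ
    exact (smul_mem_periodicSpace_iff hτ _).1 hγ
  have hmem : σ • Φ ∈ rotation (-θ) • (periodicSpace κ : Set (Crit κ)) := by
    refine ⟨_, hθ, ?_⟩
    have := rotation_mul_neg (-θ)
    rw [neg_neg] at this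
    change rotation (-θ) • rotation θ • σ • Φ = _
    rw [← mul_smul, this, one_smul]
  rw [mul_smul, mul_smul, hFeq σ hσ ⟨Φ, hΦ⟩, hF θ _ hσΦ hmem, hFeq τ hτ]
  simp only [mul_smul]

/-- The field `F` on `E^c(Ω̃)`, extended to `E^κ(ℝ²)` through the projection `latticeProj`. -/
noncomputable def projExtend (F : periodicSpace κ → periodicSpace κ) (Φ : Crit κ) : Crit κ :=
  -- A general isometry does not preserve the periodic fields, so the polar form has to live on the
  -- whole space.
  F (latticeProj κ Φ)

theorem projExtend_of_mem (F : periodicSpace κ → periodicSpace κ) {Φ : Crit κ}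
    (h : Φ ∈ periodicSpace κ) : projExtend F Φ = F ⟨Φ, h⟩ := by
  rw [projExtend, latticeProj_of_mem h]

theorem IsHomogeneousField.projExtend {F : periodicSpace κ → periodicSpace κ}
    (hF : IsHomogeneousField p F) : IsHomogeneousField p (projExtend F) :=
  hF.comp_projection (latticeProj κ)

/-- The `p`-linear map whose diagonal is `projExtend F`. -/
noncomputable def polar (p : ℕ) (F : periodicSpace κ → periodicSpace κ) :
    ContinuousMultilinearMap ℝ (fun _ : Fin p => Crit κ) (Crit κ) :=
  (p.factorial : ℝ)⁻¹ • iteratedFDeriv ℝ p (projExtend F) 0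

theorem polar_diag {F : periodicSpace κ → periodicSpace κ} (hF : IsHomogeneousField p F)
    {Φ : Crit κ} (h : Φ ∈ periodicSpace κ) : polar p F (fun _ => Φ) = F ⟨Φ, h⟩ := by
  rw [polar, smul_apply, iteratedFDeriv_of_homogeneous hF.projExtend.1 hF.projExtend.2,
    projExtend_of_mem F h, inv_smul_smul₀ (by exact_mod_cast p.factorial_ne_zero)]

/-- The fields that are periodic and stay periodic under γ form a linear subspace on which the field
commutes with γ. Taking derivatives along it passes from one field to `p` different ones. -/
theorem smul_polar {F : periodicSpace κ → periodicSpace κ} (hF : IsHomogeneousField p F)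
    (hFeq : IsD4T2Equivariant F) (hrot : IsRotationCompatible F) (γ : E2) {Ψ : Fin p → Crit κ}
    (hΨ : ∀ i, Ψ i ∈ periodicSpace κ) (hγ : ∀ i, γ • Ψ i ∈ periodicSpace κ) :
    γ • polar p F Ψ = polar p F fun i => γ • Ψ i := by
  have h := map_iteratedFDeriv_of_commute hF.projExtend.1 (actL γ)
    (periodicSpace κ ⊓ (periodicSpace κ).comap (actL γ).toLinearMap) (by
      rintro Φ ⟨h1 : Φ ∈ periodicSpace κ, h2 : γ • Φ ∈ periodicSpace κ⟩
      rw [actL_apply, actL_apply, projExtend_of_mem F h1, projExtend_of_mem F h2,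
        hrot.smul_eq hFeq γ h1 h2]) (m := Ψ) fun i => ⟨hΨ i, hγ i⟩
  change actL γ ((p.factorial : ℝ)⁻¹ • iteratedFDeriv ℝ p (projExtend F) 0 Ψ) =
    (p.factorial : ℝ)⁻¹ • iteratedFDeriv ℝ p (projExtend F) 0 fun i => γ • Ψ i
  rw [map_smul, h]; rfl

/-! ### Interactions of tuples of modes -/

/-- `γ` carries all the wave vectors `±k i` into the lattice. -/
def Straightens (γ : E2) (k : Fin p → WaveCircle κ) : Prop :=
  ∀ i Φ, γ • modeProj (k i) Φ ∈ periodicSpace κ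

/-- The interaction of the modes `k i`, transported from a position of the `k i` in the lattice. -/
noncomputable def interaction (F : periodicSpace κ → periodicSpace κ) (k : Fin p → WaveCircle κ) :
    ContinuousMultilinearMap ℝ (fun _ : Fin p => Crit κ) (Crit κ) := by
  classical
  exact if h : ∃ γ : E2, Straightens γ k then
    (actL h.choose⁻¹).compContinuousMultilinearMap
      ((polar p F).compContinuousLinearMap fun i => (actL h.choose).comp (modeProjL (k i)))
    else 0

/-- Independence of the choice: if γ and δ both straighten the tuple, `γ * δ⁻¹` takes one family of
periodic fields to the other and commutes with the polar form on it. -/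
theorem interaction_apply {F : periodicSpace κ → periodicSpace κ} (hF : IsHomogeneousField p F)
    (hFeq : IsD4T2Equivariant F) (hrot : IsRotationCompatible F) {γ : E2}
    {k : Fin p → WaveCircle κ} (hγ : Straightens γ k) (Φ : Fin p → Crit κ) :
    interaction F k Φ = γ⁻¹ • polar p F fun i => γ • modeProj (k i) (Φ i) := by
  have h : ∃ γ : E2, Straightens γ k := ⟨γ, hγ⟩
  rw [interaction, dif_pos h]
  change h.choose⁻¹ • polar p F (fun i => h.choose • modeProj (k i) (Φ i)) = _
  set δ := h.choose
  have hδ : Straightens δ k := h.choose_spec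
  have hi (i : Fin p) : (γ * δ⁻¹) • δ • modeProj (k i) (Φ i) = γ • modeProj (k i) (Φ i) := by
    rw [mul_smul, inv_smul_smul]
  have := smul_polar hF hFeq hrot (γ * δ⁻¹) (Ψ := fun i => δ • modeProj (k i) (Φ i))
    (fun i => hδ i _) (fun i => by rw [hi]; exact hγ i _)
  simp only [hi] at this
  rw [← this, mul_smul, inv_smul_smul]

theorem interaction_of_not (F : periodicSpace κ → periodicSpace κ) {k : Fin p → WaveCircle κ}
    (h : ¬ ∃ γ : E2, Straightens γ k) : interaction F k = 0 := by
  rw [interaction, dif_neg h]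

theorem straightens_comp_iff (γ δ : E2) (k : Fin p → WaveCircle κ) :
    Straightens γ (fun i => rotWave δ (k i)) ↔ Straightens (γ * δ) k := by
  refine forall_congr' fun i => ⟨fun h Φ => ?_, fun h Φ => ?_⟩
  · rw [mul_smul, smul_modeProj]; exact h _
  · rw [← smul_inv_smul δ Φ, ← smul_modeProj, ← mul_smul]; exact h _

/-- If γ straightens the moved tuple, then `γ * δ` straightens the original one, and the two
transports differ exactly by δ. Straightenability is thus invariant, so the zero values also match.
-/
theorem smul_interaction {F : periodicSpace κ → periodicSpace κ} (hF : IsHomogeneousField p F)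
    (hFeq : IsD4T2Equivariant F) (hrot : IsRotationCompatible F) (δ : E2)
    (k : Fin p → WaveCircle κ) (Φ : Fin p → Crit κ) :
    δ • interaction F k Φ = interaction F (fun i => rotWave δ (k i)) fun i => δ • Φ i := by
  by_cases h : ∃ γ : E2, Straightens γ fun i => rotWave δ (k i)
  · obtain ⟨γ, hγ⟩ := h
    rw [interaction_apply hF hFeq hrot hγ,
      interaction_apply hF hFeq hrot ((straightens_comp_iff γ δ k).1 hγ)]
    simp only [← smul_modeProj, mul_inv_rev, mul_smul, smul_inv_smul]
  · have h' : ¬ ∃ γ : E2, Straightens γ k := fun ⟨γ, hγ⟩ =>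
      h ⟨γ * δ⁻¹, (straightens_comp_iff _ _ _).2 (by rwa [inv_mul_cancel_right])⟩
    rw [interaction_of_not F h, interaction_of_not F h']
    exact map_zero (actL δ)

/-- The transport is isometric, so the bound does not depend on how far the tuple is from the
lattice. Using the amplitudes at `k i` rather than the full norms makes it summable over tuples. -/
theorem norm_interaction_le (F : periodicSpace κ → periodicSpace κ) (k : Fin p → WaveCircle κ)
    (Φ : Fin p → Crit κ) : ‖interaction F k Φ‖ ≤ ‖polar p F‖ * ∏ i, ‖amp (Φ i) (k i)‖ := by
  by_cases h : ∃ γ : E2, Straightens γ k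
  · rw [interaction, dif_pos h]
    change ‖h.choose⁻¹ • polar p F (fun i => h.choose • modeProj (k i) (Φ i))‖ ≤ _
    rw [norm_smul_crit]
    refine ((polar p F).le_opNorm _).trans ?_
    gcongr with i
    rw [norm_smul_crit]
    exact norm_modeProj_le _ _
  · rw [interaction_of_not F h]
    simp only [zero_apply, norm_zero]
    positivity

theorem summable_bound (F : periodicSpace κ → periodicSpace κ) (Φ : Fin p → Crit κ) :
    Summable fun k : Fin p → WaveCircle κ => ‖polar p F‖ * ∏ i, ‖amp (Φ i) (k i)‖ :=
  (summable_tsum_le_prod_norm (fun i k => ‖amp (Φ i) k‖) (fun _ _ => norm_nonneg _)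
    fun i => summable_norm_amp (Φ i)).1.mul_left _

theorem summable_interaction (F : periodicSpace κ → periodicSpace κ) (Φ : Fin p → Crit κ) :
    Summable fun k : Fin p → WaveCircle κ => interaction F k Φ :=
  (summable_bound F Φ).of_norm_bounded fun k => norm_interaction_le F k Φ

/-! ### The extension as a sum over all tuples -/

/-- The sum of all interactions of `p` modes. -/
noncomputable def totalInteraction (p : ℕ) (F : periodicSpace κ → periodicSpace κ) :
    ContinuousMultilinearMap ℝ (fun _ : Fin p => Crit κ) (Crit κ) :=
  MultilinearMap.mkContinuous
    { toFun := fun Φ => ∑' k : Fin p → WaveCircle κ, interaction F k Φ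
      map_update_add' := fun Φ i x y => by
        simp only [ContinuousMultilinearMap.map_update_add]
        exact (summable_interaction F _).tsum_add (summable_interaction F _)
      map_update_smul' := fun Φ i c x => by
        simp only [ContinuousMultilinearMap.map_update_smul]
        exact (summable_interaction F _).tsum_const_smul c }
    ‖polar p F‖ fun Φ => by
      refine (tsum_of_norm_bounded (summable_bound F Φ).hasSum
        fun k => norm_interaction_le F k Φ).trans ?_
      rw [tsum_mul_left]
      refine mul_le_mul_of_nonneg_left ?_ (norm_nonneg (polar p F))
      simp only [norm_crit]
      exact (summable_tsum_le_prod_norm (fun i k => ‖amp (Φ i) k‖) (fun _ _ => norm_nonneg _)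
        fun i => summable_norm_amp (Φ i)).2

theorem totalInteraction_apply (F : periodicSpace κ → periodicSpace κ) (Φ : Fin p → Crit κ) :
    totalInteraction p F Φ = ∑' k : Fin p → WaveCircle κ, interaction F k Φ := rfl

theorem smul_totalInteraction {F : periodicSpace κ → periodicSpace κ}
    (hF : IsHomogeneousField p F) (hFeq : IsD4T2Equivariant F) (hrot : IsRotationCompatible F)
    (γ : E2) (Φ : Fin p → Crit κ) :
    γ • totalInteraction p F Φ = totalInteraction p F fun i => γ • Φ i := by
  rw [totalInteraction_apply, totalInteraction_apply, ← actL_apply,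
    (actL γ).map_tsum (summable_interaction F Φ)]
  -- The linear part of γ permutes the tuples of wave vectors, so the right-hand sum may be
  -- reindexed by it.
  rw [← (Equiv.piCongrRight fun _ : Fin p => rotWave (κ := κ) γ).tsum_eq
    fun k => interaction F k fun i => γ • Φ i]
  exact tsum_congr fun k => smul_interaction hF hFeq hrot γ k Φ

theorem interaction_of_lattice {F : periodicSpace κ → periodicSpace κ}
    (hF : IsHomogeneousField p F) (hFeq : IsD4T2Equivariant F) (hrot : IsRotationCompatible F)
    {k : Fin p → WaveCircle κ} (hk : ∀ i, k i ∈ latticeWaves κ) (Φ : Fin p → Crit κ) :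
    interaction F k Φ = polar p F fun i => modeProj (k i) (Φ i) := by
  have h1 : Straightens 1 k := fun i Ψ => by rw [one_smul]; exact modeProj_mem (hk i) Ψ
  simpa using interaction_apply hF hFeq hrot h1 Φ

theorem totalInteraction_of_mem {F : periodicSpace κ → periodicSpace κ}
    (hF : IsHomogeneousField p F) (hFeq : IsD4T2Equivariant F) (hrot : IsRotationCompatible F)
    {Φ : Fin p → Crit κ} (hΦ : ∀ i, Φ i ∈ periodicSpace κ) :
    totalInteraction p F Φ = polar p F Φ := by
  classical
  set K := (finite_latticeWaves (κ := κ)).toFinset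
  rw [totalInteraction_apply, tsum_eq_sum (s := Fintype.piFinset fun _ => K)]
  · calc ∑ k ∈ Fintype.piFinset fun _ => K, interaction F k Φ
        = ∑ k ∈ Fintype.piFinset fun _ => K, polar p F fun i => modeProj (k i) (Φ i) :=
          Finset.sum_congr rfl fun k hk => interaction_of_lattice hF hFeq hrot (fun i => by
            simpa [K] using Fintype.mem_piFinset.1 hk i) Φ
      _ = polar p F fun i => ∑ k ∈ K, modeProj k (Φ i) :=
          ((polar p F).map_sum_finset (fun i k => modeProj k (Φ i)) fun _ => K).symm
      _ = polar p F Φ := by simp only [K, sum_modeProj (hΦ _)]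
  -- A tuple with an entry off the lattice meets a vanishing amplitude, so the norm bound makes its
  -- term zero.
  · intro k hk
    obtain ⟨i, hi⟩ : ∃ i, k i ∉ latticeWaves κ := by
      simpa [K, Fintype.mem_piFinset] using hk
    have h0 : amp (Φ i) (k i) = 0 := by
      by_contra h
      exact hi (mem_periodicSpace_iff_amp.1 (hΦ i) _ h)
    have := norm_interaction_le F k Φ
    rw [Finset.prod_eq_zero (Finset.mem_univ i) (by rw [h0, norm_zero]), mul_zero] at this
    exact norm_le_zero_iff.1 this

theorem exists_extension {F : periodicSpace κ → periodicSpace κ}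
    (hF : IsHomogeneousField p F) (hFeq : IsD4T2Equivariant F) (hrot : IsRotationCompatible F) :
    ∃ G : Crit κ → Crit κ, IsHomogeneousField p G ∧ IsE2Equivariant G ∧
      ∀ Φ : periodicSpace κ, (F Φ : Crit κ) = G Φ := by
  refine ⟨fun Φ => totalInteraction p F fun _ => Φ, ⟨?_, fun c Φ => ?_⟩, fun γ Φ => ?_,
    fun Φ => ?_⟩
  · exact (totalInteraction p F).contDiff.comp (contDiff_pi.2 fun _ => contDiff_id)
  · have := (totalInteraction p F).map_smul_univ (fun _ => c) fun _ => Φ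
    simpa using this
  · exact smul_totalInteraction hF hFeq hrot γ _
  · change _ = totalInteraction p F fun _ => (Φ : Crit κ)
    rw [totalInteraction_of_mem hF hFeq hrot fun _ => Φ.2, polar_diag hF Φ.2]

end EuclideanModes

theorem mainTheorem1 (l₁ n₁ l₂ n₂ : ℕ) (h₁ : n₁ ≤ l₁) (h₂ : n₂ ≤ l₂) (hl : l₂ < l₁)
    (κ : ℝ) (hκ : 0 < κ)
    (hκ₁ : κ ^ 2 = (l₁ : ℝ) ^ 2 + (n₁ : ℝ) ^ 2) (hκ₂ : κ ^ 2 = (l₂ : ℝ) ^ 2 + (n₂ : ℝ) ^ 2)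
    (hV : periodicSpace κ = irrep κ l₁ n₁ ⊔ irrep κ l₂ n₂)
    (p : ℕ) (F : periodicSpace κ → periodicSpace κ)
    (hF : IsHomogeneousField p F) (hFeq : IsD4T2Equivariant F) :
    (∃ G : Crit κ → Crit κ, IsHomogeneousField p G ∧ IsE2Equivariant G ∧
        ∀ Φ : periodicSpace κ, (F Φ : Crit κ) = G Φ) ↔
      ∀ (θ : ℝ) (Φ : Crit κ) (hΦ : Φ ∈ periodicSpace κ)
        (hΦθ : Φ ∈ rotation (-θ) • (periodicSpace κ : Set (Crit κ))),
        rotation θ • (F ⟨Φ, hΦ⟩ : Crit κ) = F ⟨rotation θ • Φ, rotation_smul_mem hΦθ⟩ := by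
  refine ⟨?_, exists_extension hF hFeq⟩
  rintro ⟨G, -, hG, hFG⟩ θ Φ hΦ hΦθ
  rw [hFG, hFG]
  exact hG _ _
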